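/- There is an absolute constant $C>0$ such that the following holds. Let $p\in\mathbb{Z}[x]$ be a polynomial of degree $d\ge 1$ that is square-free in $\mathbb{Q}[x]$, and let $L\in\mathbb{N}$ be such that every coefficient of $p$ has absolute value less than $2^L$. Let $I=[-2^L,2^L]$. The Sturm sequence of $p$ is $p_0=p$, $p_1=p'$, $p_i=-\operatorname{rem}(p_{i-2},p_{i-1})$, ending with its last nonzero term $p_N$, and $V(a)$ is the number of sign changes of $(p_0(a),\dots,p_N(a))$, with zeros discarded. Say that an interval $[a,b]$ is terminal if $V(a)-V(b)\in\{0,1\}$. Sturm bisection starts with $I$ and repeatedly splits each non-terminal interval at its midpoint into two closed halves, until all intervals are terminal. For $x\in I$ let $F(x)=\operatorname{dist}_2(x)\in(0,\infty]$ be the distance from $x$ to the second closest real root of $p$ ($F(x)=\infty$ if $p$ has fewer than two real roots). Then: 1. $F$ is a stopping function: if $x\in J\subseteq I$ for an interval $J=[a,b]$ of width $b-a<F(x)$, then $J$ is terminal. 2. $\displaystyle\int_I\frac{2\,dx}{F(x)}\le C\,d\,(L+\ln d)$. 3. Sturm bisection of $I$ terminates; the number $\#Q$ of intervals in the final partition (the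 leaves of the subdivision tree) satisfies $\#Q\le\max\{1,\int_I 2\,dx/F(x)\}$; and the size (the total number of nodes) of the subdivision tree is at most $C\,d\,(L+\ln d)$, that is, $O(d(L+\ln d))$. -/

import Mathlib

noncomputable section

namespace SturmBisection

open Classical in
/-- The negated remainder sequence `f, g, -(f % g), …`, which stops as soon as the next entry
would be the zero polynomial. -/
def remainderSeq (f g : Polynomial ℝ) : List (Polynomial ℝ) :=
  if h : g = 0 then [f] else f :: remainderSeq g (-(f % g))
termination_by g.degree
decreasing_by
  rw [Polynomial.degree_neg]
  exact EuclideanDomain.mod_lt f h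

/-- The Sturm sequence `p, p', …` of a real polynomial. -/
def sturmSeq (p : Polynomial ℝ) : List (Polynomial ℝ) :=
  remainderSeq p (Polynomial.derivative p)

/-- The number of sign changes in a finite sequence of real numbers; zeros are discarded. -/
def signChanges (l : List ℝ) : ℕ :=
  (((l.map SignType.sign).filter (fun s => s ≠ 0)).destutter (fun s t => s ≠ t)).length - 1

/-- The variation at `x` of the Sturm sequence of `p`. -/
def sturmVariation (p : Polynomial ℝ) (x : ℝ) : ℕ :=
  signChanges ((sturmSeq p).map (fun q => q.eval x))

/-- The Sturm predicate on the interval `[a, b]`: the variations of the Sturm sequence at the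
two endpoints are equal (exclusion), or differ by exactly one (inclusion). -/
def SturmPredicate (p : Polynomial ℝ) (a b : ℝ) : Prop :=
  (sturmVariation p a : ℤ) - sturmVariation p b = 0 ∨
    (sturmVariation p a : ℤ) - sturmVariation p b = 1

/-- The shape of a finite subdivision tree of bisection: every node is terminal or has exactly
two children. -/
inductive SubdivisionTree : Type
  | leaf : SubdivisionTree
  | node (l r : SubdivisionTree) : SubdivisionTree

/-- The number of leaves, that is, of intervals in the final partition. -/
def SubdivisionTree.numLeaves : SubdivisionTree → ℕ
  | .leaf => 1
  | .node l r => l.numLeaves + r.numLeaves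

/-- The total number of nodes, both internal nodes and leaves. -/
def SubdivisionTree.size : SubdivisionTree → ℕ
  | .leaf => 1
  | .node l r => 1 + l.size + r.size

/-- `T.IsTreeOf B a b`: the bisection algorithm with predicate `B`, started on `[a, b]`, stops
and `T` is its subdivision tree. An interval is terminal if `B` is true on it, and otherwise
it is split at its midpoint and the algorithm is applied to both halves. -/
def SubdivisionTree.IsTreeOf (B : ℝ → ℝ → Prop) : SubdivisionTree → ℝ → ℝ → Prop
  | .leaf, a, b => B a b
  | .node l r, a, b =>
      ¬ B a b ∧ l.IsTreeOf B a ((a + b) / 2) ∧ r.IsTreeOf B ((a + b) / 2) b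

/-- `F` is a stopping function on `[a, b]` for the predicate `B`: if `x` lies in a subinterval
`[c, e]` whose width is less than `F x`, then `B` is true on `[c, e]`. -/
def IsStoppingFunction (B : ℝ → ℝ → Prop) (a b : ℝ) (F : ℝ → ENNReal) : Prop :=
  ∀ x c e : ℝ, a ≤ c → e ≤ b → x ∈ Set.Icc c e → ENNReal.ofReal (e - c) < F x → B c e

/-- The real roots of an integer polynomial. -/
def realRoots (p : Polynomial ℤ) : Set ℝ := {α : ℝ | Polynomial.aeval α p = 0}

/-- The distance from `x` to the second closest point of `S`: the least `r` such that two
different points of `S` lie within distance `r` of `x`. It is infinite if `S` has fewer than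
two points. -/
def dist₂ (x : ℝ) (S : Set ℝ) : ENNReal :=
  ⨅ α ∈ S, ⨅ β ∈ S, ⨅ _ : α ≠ β, max (edist x α) (edist x β)

/-- The Sturm predicate of an integer polynomial. -/
abbrev sturmPred (p : Polynomial ℤ) : ℝ → ℝ → Prop :=
  SturmPredicate (p.map (Int.castRingHom ℝ))

end SturmBisection

end

namespace SturmBisection

open Polynomial Filter Topology

/-! ### Sign changes of a list of reals -/

section SignChanges

/-! Sturm's theorem (`sturmVariation_sub`) makes the predicate hold on every interval with at most
one root. If an interval contains `x` and two roots, both are within its width of `x`; hence `dist₂`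
is a stopping function.

For the leaf count, the parent of a leaf is not terminal, so `F` is at most the parent's width,
which is twice the leaf's. Hence `2 / F` has integral at least 1 over each leaf that is not the
root. A binary tree with `n` leaves has `2n - 1` nodes. Termination follows from a uniform positive
lower bound for `dist₂`.

For the integral, `1 / F` is at most a sum over pairs of consecutive roots of `1 / (|x - m| + h)`,
with `m` the midpoint and `h` half the gap (`IsSucc.two_div_dist₂_le`). Each term integrates to a
logarithm, which leaves the sum of `-log gap` to bound (`IsSucc.neg_sum_log_gap_le`). Since the
resultant of `p` and `p'` is a nonzero integer, the product of `|p'|` over the complex roots cannot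
be too small. At a real root with a successor, `|p'|` is at most the gap times a bound for `|p''|`;
at other roots a crude bound suffices. The sizes of the roots enter through `log⁺` and are
controlled together by the Mahler measure, so the total is linear in `d` up to the factor `L + log
d`. -/

theorem signChanges_cons_zero (l : List ℝ) : signChanges (0 :: l) = signChanges l := by
  simp [signChanges]

theorem signChanges_singleton (a : ℝ) : signChanges [a] = 0 := by
  by_cases ha : SignType.sign a = 0 <;> simp [signChanges, ha]

theorem signChanges_cons_cons {a b : ℝ} (ha : a ≠ 0) (hb : b ≠ 0) (l : List ℝ) :
    signChanges (a :: b :: l) =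
      (if SignType.sign a = SignType.sign b then 0 else 1) + signChanges (b :: l) := by
  have ha' : SignType.sign a ≠ 0 := by simpa using ha
  have hb' : SignType.sign b ≠ 0 := by simpa using hb
  simp only [signChanges, List.map_cons, List.filter_cons, ha', hb', ne_eq, not_false_eq_true,
    decide_true, if_true, List.destutter_cons_cons]
  have key : ∀ l' : List SignType, 1 ≤ (List.destutter' (fun s t => ¬s = t)
      (SignType.sign b) l').length := fun l' => by
    rw [Nat.one_le_iff_ne_zero, Ne, List.length_eq_zero_iff]
    exact List.destutter'_ne_nil _ _
  split_ifs with h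
  · rw [h, zero_add]; rfl
  · simp only [List.destutter_cons', List.length_cons]
    have := key (List.filter (fun s => decide (¬s = 0)) (List.map (⇑SignType.sign) l))
    omega

theorem signChanges_cons_cons_pos {a b : ℝ} (h : 0 < a * b) (l : List ℝ) :
    signChanges (a :: b :: l) = signChanges (b :: l) := by
  have ha : a ≠ 0 := left_ne_zero_of_mul h.ne'
  have hb : b ≠ 0 := right_ne_zero_of_mul h.ne'
  rw [signChanges_cons_cons ha hb]
  rcases pos_and_pos_or_neg_and_neg_of_mul_pos h with ⟨h1, h2⟩ | ⟨h1, h2⟩ <;> simp [h1, h2]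

theorem signChanges_cons_cons_neg {a b : ℝ} (h : a * b < 0) (l : List ℝ) :
    signChanges (a :: b :: l) = 1 + signChanges (b :: l) := by
  have ha : a ≠ 0 := left_ne_zero_of_mul h.ne
  have hb : b ≠ 0 := right_ne_zero_of_mul h.ne
  rw [signChanges_cons_cons ha hb]
  rcases mul_neg_iff.mp h with ⟨h1, h2⟩ | ⟨h1, h2⟩ <;> simp [h1, h2]

/-- Between opposite signs the middle entry is irrelevant, even if it is zero. This is why a zero of
an inner Sturm polynomial does not alter the variation. -/
theorem signChanges_cons_cons_cons_neg {a b c : ℝ} (h : a * c < 0) (l : List ℝ) :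
    signChanges (a :: b :: c :: l) = 1 + signChanges (c :: l) := by
  have ha : a ≠ 0 := left_ne_zero_of_mul h.ne
  have hc : c ≠ 0 := right_ne_zero_of_mul h.ne
  rcases eq_or_ne b 0 with rfl | hb
  · have : signChanges (a :: 0 :: c :: l) = signChanges (a :: c :: l) := by
      have ha' : SignType.sign a ≠ 0 := by simpa using ha
      simp [signChanges, List.filter_cons, ha']
    rw [this, signChanges_cons_cons_neg h]
  · rw [signChanges_cons_cons ha hb, signChanges_cons_cons hb hc]
    rcases mul_neg_iff.mp h with ⟨h1, h2⟩ | ⟨h1, h2⟩ <;>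
      rcases lt_or_gt_of_ne hb with h3 | h3 <;> simp [h1, h2, h3]

end SignChanges

/-! ### Negated remainder sequences near a point -/

section RemainderSequence

theorem remainderSeq_zero (f : ℝ[X]) : remainderSeq f 0 = [f] := by
  rw [remainderSeq]; simp

theorem remainderSeq_of_ne {f g : ℝ[X]} (hg : g ≠ 0) :
    remainderSeq f g = f :: remainderSeq g (-(f % g)) := by
  rw [remainderSeq]; simp [hg]

theorem exists_remainderSeq_eq_cons (f g : ℝ[X]) : ∃ t, remainderSeq f g = f :: t := by
  rcases eq_or_ne g 0 with rfl | hg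
  · exact ⟨[], remainderSeq_zero f⟩
  · exact ⟨_, remainderSeq_of_ne hg⟩

/-- The number of sign changes at `x` of the negated remainder sequence of `f` and `g`. -/
noncomputable def variation (f g : ℝ[X]) (x : ℝ) : ℕ :=
  signChanges ((remainderSeq f g).map (fun q => q.eval x))

theorem variation_of_mul_pos {f g : ℝ[X]} {x : ℝ} (h : 0 < f.eval x * g.eval x) :
    variation f g x = variation g (-(f % g)) x := by
  have hg : g ≠ 0 := by rintro rfl; simp at h
  obtain ⟨t, ht⟩ := exists_remainderSeq_eq_cons g (-(f % g))
  rw [variation, variation, remainderSeq_of_ne hg, ht]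
  exact signChanges_cons_cons_pos h _

theorem variation_of_mul_neg {f g : ℝ[X]} {x : ℝ} (h : f.eval x * g.eval x < 0) :
    variation f g x = 1 + variation g (-(f % g)) x := by
  have hg : g ≠ 0 := by rintro rfl; simp at h
  obtain ⟨t, ht⟩ := exists_remainderSeq_eq_cons g (-(f % g))
  rw [variation, variation, remainderSeq_of_ne hg, ht]
  exact signChanges_cons_cons_neg h _

theorem variation_of_eval_eq_zero {f g : ℝ[X]} {x : ℝ} (hg : g ≠ 0) (h : f.eval x = 0) :
    variation f g x = variation g (-(f % g)) x := by
  rw [variation, variation, remainderSeq_of_ne hg, List.map_cons, h, signChanges_cons_zero]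

theorem variation_of_mul_mod_neg {f g : ℝ[X]} {x : ℝ} (hg : g ≠ 0)
    (h : f.eval x * (-(f % g)).eval x < 0) :
    variation f g x = 1 + variation (-(f % g)) (-(g % -(f % g))) x := by
  have hr : -(f % g) ≠ 0 := by intro h0; simp [h0] at h
  obtain ⟨t, ht⟩ := exists_remainderSeq_eq_cons (-(f % g)) (-(g % -(f % g)))
  rw [variation, variation, remainderSeq_of_ne hg, remainderSeq_of_ne hr, ht]
  exact signChanges_cons_cons_cons_neg h _

theorem isCoprime_neg_mod {f g : ℝ[X]} (h : IsCoprime f g) : IsCoprime g (-(f % g)) := by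
  have : -(f % g) = -f + g * (f / g) := by
    rw [EuclideanDomain.mod_eq_sub_mul_div]; ring
  rw [this, IsCoprime.add_mul_left_right_iff]
  exact h.symm.neg_right

/-- The recursion passes only through pairs whose first entry is nonzero at `x₀`. If `g` is nonzero
there, the first two signs persist nearby and one entry is dropped. If `g` vanishes, the next entry
equals `-f` at `x₀`, so the three entries contribute one change and two are dropped. -/
theorem eventually_variation_eq {x₀ : ℝ} (f g : ℝ[X]) (hfg : IsCoprime f g)
    (hf : f.eval x₀ ≠ 0) : ∀ᶠ x in 𝓝 x₀, variation f g x = variation f g x₀ := by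
  have main : ∀ (n : ℕ) (f g : ℝ[X]), g.degree < n → IsCoprime f g → f.eval x₀ ≠ 0 →
      ∀ᶠ x in 𝓝 x₀, variation f g x = variation f g x₀ := by
    intro n
    induction n with
    | zero =>
      intro f g hn _ _
      have : g = 0 := by
        by_contra h
        rw [degree_eq_natDegree h] at hn
        exact absurd hn (by simp)
      subst this
      simp [variation, remainderSeq_zero, signChanges_singleton]
    | succ n ih =>
      intro f g hn hfg hf
      rcases eq_or_ne g 0 with rfl | hg
      · simp [variation, remainderSeq_zero, signChanges_singleton]
      have hdeg : (-(f % g)).degree < g.degree := by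
        rw [degree_neg]; exact EuclideanDomain.mod_lt f hg
      have hgn : g.degree ≤ n := by
        rw [degree_eq_natDegree hg] at hn ⊢
        exact_mod_cast Nat.lt_succ_iff.mp (by exact_mod_cast hn)
      have hcop := isCoprime_neg_mod hfg
      by_cases hgx : g.eval x₀ = 0
      · have hr : (-(f % g)).eval x₀ = -f.eval x₀ := by
          rw [EuclideanDomain.mod_eq_sub_mul_div]; simp [hgx]
        have hr0 : (-(f % g)).eval x₀ ≠ 0 := by rw [hr]; simpa using hf
        have hrne : -(f % g) ≠ 0 := by intro h0; simp [h0] at hr0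
        have hneg : f.eval x₀ * (-(f % g)).eval x₀ < 0 := by
          rw [hr]; have := mul_self_pos.mpr hf; linarith
        have hdeg2 : (-(g % -(f % g))).degree < (-(f % g)).degree := by
          rw [degree_neg (g % _)]; exact EuclideanDomain.mod_lt g hrne
        have h1 := ih _ _ (hdeg2.trans (hdeg.trans_le hgn)) (isCoprime_neg_mod hcop) hr0
        have h2 : ∀ᶠ x in 𝓝 x₀, f.eval x * (-(f % g)).eval x < 0 :=
          (f.continuous.mul (-(f % g)).continuous).continuousAt.eventually_lt
            continuousAt_const hneg
        filter_upwards [h1, h2] with x hx1 hx2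
        rw [variation_of_mul_mod_neg hg hx2, variation_of_mul_mod_neg hg hneg, hx1]
      · have h1 := ih _ _ (hdeg.trans_le hgn) hcop hgx
        have hc : ContinuousAt (fun x => f.eval x * g.eval x) x₀ :=
          (f.continuous.mul g.continuous).continuousAt
        rcases lt_or_gt_of_ne (mul_ne_zero hf hgx) with hneg | hpos
        · filter_upwards [h1, hc.eventually_lt continuousAt_const hneg] with x hx1 hx2
          rw [variation_of_mul_neg hx2, variation_of_mul_neg hneg, hx1]
        · filter_upwards [h1, continuousAt_const.eventually_lt hc hpos] with x hx1 hx2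
          rw [variation_of_mul_pos hx2, variation_of_mul_pos hpos, hx1]
  exact main (g.natDegree + 1) f g
    (degree_le_natDegree.trans_lt (by exact_mod_cast Nat.lt_succ_self _)) hfg hf

end RemainderSequence

/-! ### Sturm's theorem -/

section SturmTheorem

theorem sturmVariation_eq (p : ℝ[X]) : sturmVariation p = variation p (derivative p) := rfl

/-- `p p'` changes sign from negative to positive at a simple root. -/
theorem eventually_mul_derivative_sign {p : ℝ[X]} {x₀ : ℝ} (h0 : p.eval x₀ = 0)
    (h1 : (derivative p).eval x₀ ≠ 0) :
    ∀ᶠ x in 𝓝 x₀, (x < x₀ → p.eval x * (derivative p).eval x < 0) ∧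
      (x₀ < x → 0 < p.eval x * (derivative p).eval x) := by
  obtain ⟨q, hq⟩ := dvd_iff_isRoot.mpr h0
  have hd : (derivative p).eval x₀ = q.eval x₀ := by
    rw [hq]; simp [derivative_mul]
  have hpos : 0 < q.eval x₀ * (derivative p).eval x₀ := by
    rw [hd]; rw [hd] at h1; exact mul_self_pos.mpr h1
  have hc : ContinuousAt (fun x => q.eval x * (derivative p).eval x) x₀ :=
    (q.continuous.mul (derivative p).continuous).continuousAt
  filter_upwards [continuousAt_const.eventually_lt hc hpos] with x hx
  have hpx : p.eval x * (derivative p).eval x =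
      (x - x₀) * (q.eval x * (derivative p).eval x) := by
    conv_lhs => rw [hq]
    simp only [eval_mul, eval_sub, eval_X, eval_C]
    rw [← hq]; ring
  rw [hpx]
  exact ⟨fun h => mul_neg_of_neg_of_pos (by linarith) hx,
    fun h => mul_pos (by linarith) hx⟩

/-- At a root the leading zero is discarded and the tail, starting with `p'` nonzero, is locally
constant. Just to the left `p p' < 0` adds one change; just to the right `p p' > 0` adds none. -/
theorem eventually_sturmVariation {p : ℝ[X]} (hp : p.Separable) (x₀ : ℝ) :
    ∀ᶠ x in 𝓝 x₀, sturmVariation p x =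
      sturmVariation p x₀ + (if x < x₀ ∧ p.eval x₀ = 0 then 1 else 0) := by
  rw [sturmVariation_eq]
  by_cases h0 : p.eval x₀ = 0
  · have h1 : (derivative p).eval x₀ ≠ 0 := by
      intro h1
      obtain ⟨a, b, hab⟩ := hp
      have := congrArg (eval x₀) hab
      simp [h0, h1] at this
    have hg : derivative p ≠ 0 := by rintro h; simp [h] at h1
    filter_upwards [eventually_mul_derivative_sign h0 h1,
      eventually_variation_eq _ _ (isCoprime_neg_mod hp) h1] with x hx hv
    rw [variation_of_eval_eq_zero hg h0, ← hv]
    rcases lt_trichotomy x x₀ with h | rfl | h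
    · rw [variation_of_mul_neg (hx.1 h)]; simp [h, h0, add_comm]
    · rw [variation_of_eval_eq_zero hg h0]; simp
    · rw [variation_of_mul_pos (hx.2 h)]; simp [h.le]
  · filter_upwards [eventually_variation_eq p _ hp h0] with x hx
    simp [hx, h0]

open Classical in
/-- **Sturm's theorem**: for a separable polynomial, the variation of the Sturm sequence drops
by the number of roots in `(a, b]`. -/
theorem sturmVariation_sub {p : ℝ[X]} (hp : p.Separable) {a b : ℝ} (hab : a ≤ b) :
    (sturmVariation p a : ℤ) - sturmVariation p b =
      (p.roots.toFinset.filter (fun r => a < r ∧ r ≤ b)).card := by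
  have hp0 : p ≠ 0 := hp.ne_zero
  set R := p.roots.toFinset with hR
  have hmem : ∀ r, r ∈ R ↔ p.eval r = 0 := fun r => by
    rw [hR, Multiset.mem_toFinset, mem_roots hp0, IsRoot]
  -- The drop of the variation as `x` reaches a root cancels the jump of the root count, and ℝ is
  -- connected.
  have hloc : IsLocallyConstant
      (fun x => sturmVariation p x + (R.filter (fun r => r ≤ x)).card) := by
    rw [IsLocallyConstant.iff_eventually_eq]
    intro x₀
    have hne : ∀ᶠ x in 𝓝 x₀, ∀ r ∈ R, r ≠ x₀ → (r ≤ x ↔ r ≤ x₀) := by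
      rw [eventually_all_finset]
      intro r _
      rcases lt_trichotomy r x₀ with h | h | h
      · filter_upwards [lt_mem_nhds h] with x hx _
        exact ⟨fun _ => h.le, fun _ => hx.le⟩
      · exact Eventually.of_forall fun x hx => absurd h hx
      · filter_upwards [gt_mem_nhds h] with x hx _
        exact ⟨fun h' => absurd hx h'.not_gt, fun h' => absurd h h'.not_gt⟩
    filter_upwards [eventually_sturmVariation hp x₀, hne] with x hx hr
    rw [hx]
    by_cases hc : x < x₀ ∧ p.eval x₀ = 0
    · rw [if_pos hc]
      have : R.filter (fun r => r ≤ x₀) = insert x₀ (R.filter (fun r => r ≤ x)) := by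
        ext r
        simp only [Finset.mem_filter, Finset.mem_insert]
        constructor
        · rintro ⟨h1, h2⟩
          rcases eq_or_ne r x₀ with h | h
          · exact Or.inl h
          · exact Or.inr ⟨h1, (hr r h1 h).mpr h2⟩
        · rintro (rfl | ⟨h1, h2⟩)
          · exact ⟨(hmem _).mpr hc.2, le_rfl⟩
          · exact ⟨h1, h2.trans hc.1.le⟩
      rw [this, Finset.card_insert_of_notMem]
      · ring
      · simp [hc.1]
    · rw [if_neg hc]
      have : R.filter (fun r => r ≤ x) = R.filter (fun r => r ≤ x₀) := by
        apply Finset.filter_congr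
        intro r h1
        rcases eq_or_ne r x₀ with rfl | h
        · simp only [le_refl, iff_true]
          by_contra hlt
          exact hc ⟨not_le.mp hlt, (hmem _).mp h1⟩
        · exact hr r h1 h
      rw [this, add_zero]
  have heq := hloc.apply_eq_of_isPreconnected isPreconnected_univ (Set.mem_univ a)
    (Set.mem_univ b)
  have hsplit : R.filter (fun r => r ≤ b) =
      R.filter (fun r => r ≤ a) ∪ R.filter (fun r => a < r ∧ r ≤ b) := by
    ext r
    simp only [Finset.mem_filter, Finset.mem_union]
    rcases le_or_gt r a with h | h
    · simp [h, h.trans hab, h.not_gt]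
    · simp [h, h.not_ge]
  rw [hsplit, Finset.card_union_of_disjoint] at heq
  · omega
  · rw [Finset.disjoint_filter]
    intro r _ h1 h2
    exact absurd h2.1 h1.not_gt

theorem sturmPredicate_of_subsingleton {p : ℝ[X]} (hp : p.Separable) {a b : ℝ} (hab : a ≤ b)
    (h : ∀ α ∈ Set.Icc a b, ∀ β ∈ Set.Icc a b, p.eval α = 0 → p.eval β = 0 → α = β) :
    SturmPredicate p a b := by
  classical
  rw [SturmPredicate, sturmVariation_sub hp hab]
  have : (p.roots.toFinset.filter (fun r => a < r ∧ r ≤ b)).card ≤ 1 := by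
    rw [Finset.card_le_one]
    intro α hα β hβ
    simp only [Finset.mem_filter, Multiset.mem_toFinset, mem_roots hp.ne_zero, IsRoot] at hα hβ
    exact h α ⟨hα.2.1.le, hα.2.2⟩ β ⟨hβ.2.1.le, hβ.2.2⟩ hα.1 hβ.1
  omega

end SturmTheorem

end SturmBisection

namespace SturmBisection

open MeasureTheory
open scoped ENNReal

/-! ### Subdivision trees and the leaf count -/

section Trees

theorem SubdivisionTree.size_add_one (T : SubdivisionTree) : T.size + 1 = 2 * T.numLeaves := by
  induction T with
  | leaf => rfl
  | node l r hl hr => simp only [SubdivisionTree.size, SubdivisionTree.numLeaves]; omega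

theorem IsStoppingFunction.mono {B : ℝ → ℝ → Prop} {a b a' b' : ℝ} {F : ℝ → ℝ≥0∞}
    (h : IsStoppingFunction B a b F) (ha : a ≤ a') (hb : b' ≤ b) :
    IsStoppingFunction B a' b' F :=
  fun x c e hc he => h x c e (ha.trans hc) (he.trans hb)

/-- Here `w` plays the width of the parent interval: the constant `2 / w` integrates to exactly 1
over one half. -/
theorem one_le_setLIntegral_of_le {F : ℝ → ℝ≥0∞} {a b w : ℝ} (hab : a < b)
    (hw : w = 2 * (b - a)) (hF : ∀ x ∈ Set.Ioc a b, F x ≤ ENNReal.ofReal w) :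
    1 ≤ ∫⁻ x in Set.Ioc a b, 2 / F x := by
  have hw0 : ENNReal.ofReal w ≠ 0 := by
    rw [Ne, ENNReal.ofReal_eq_zero]; linarith
  calc (1 : ℝ≥0∞) = ∫⁻ _ in Set.Ioc a b, 2 / ENNReal.ofReal w := by
        rw [setLIntegral_const, Real.volume_Ioc, ENNReal.mul_comm_div,
          show (2 : ℝ≥0∞) = ENNReal.ofReal 2 by simp, ← mul_div_assoc,
          ← ENNReal.ofReal_mul zero_le_two, ← hw, ENNReal.div_self hw0 ENNReal.ofReal_ne_top]
    _ ≤ ∫⁻ x in Set.Ioc a b, 2 / F x :=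
        setLIntegral_mono' measurableSet_Ioc fun x hx => ENNReal.div_le_div_left (hF x hx) _

/-- A one-leaf tree has no failing parent, so it is excluded. Half-open intervals keep the two
halves disjoint. -/
theorem SubdivisionTree.numLeaves_le_of_ne_leaf {B : ℝ → ℝ → Prop} {F : ℝ → ℝ≥0∞}
    (T : SubdivisionTree) (hT : T ≠ .leaf) {a b : ℝ} (hab : a < b) (h : T.IsTreeOf B a b)
    (hF : IsStoppingFunction B a b F) :
    (T.numLeaves : ℝ≥0∞) ≤ ∫⁻ x in Set.Ioc a b, 2 / F x := by
  induction T generalizing a b with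
  | leaf => exact absurd rfl hT
  | node l r hl hr =>
    obtain ⟨hB, h1, h2⟩ := h
    have hFle : ∀ x ∈ Set.Icc a b, F x ≤ ENNReal.ofReal (b - a) := by
      intro x hx
      by_contra hlt
      exact hB (hF x a b le_rfl le_rfl hx (not_le.mp hlt))
    have ham : a < (a + b) / 2 := by linarith
    have hmb : (a + b) / 2 < b := by linarith
    have key1 : (l.numLeaves : ℝ≥0∞) ≤ ∫⁻ x in Set.Ioc a ((a + b) / 2), 2 / F x := by
      by_cases hl' : l = .leaf
      · subst hl'
        simpa [SubdivisionTree.numLeaves] using one_le_setLIntegral_of_le ham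
          (show b - a = _ by ring) fun x hx => hFle x ⟨hx.1.le, hx.2.trans hmb.le⟩
      · exact hl hl' ham h1 (hF.mono le_rfl hmb.le)
    have key2 : (r.numLeaves : ℝ≥0∞) ≤ ∫⁻ x in Set.Ioc ((a + b) / 2) b, 2 / F x := by
      by_cases hr' : r = .leaf
      · subst hr'
        simpa [SubdivisionTree.numLeaves] using one_le_setLIntegral_of_le hmb
          (show b - a = _ by ring) fun x hx => hFle x ⟨(ham.trans hx.1).le, hx.2⟩
      · exact hr hr' hmb h2 (hF.mono ham.le le_rfl)
    rw [← Set.Ioc_union_Ioc_eq_Ioc ham.le hmb.le,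
      lintegral_union measurableSet_Ioc (Set.Ioc_disjoint_Ioc_of_le le_rfl)]
    simp only [SubdivisionTree.numLeaves, Nat.cast_add]
    exact add_le_add key1 key2

theorem SubdivisionTree.numLeaves_le {B : ℝ → ℝ → Prop} {F : ℝ → ℝ≥0∞}
    (T : SubdivisionTree) {a b : ℝ} (hab : a < b) (h : T.IsTreeOf B a b)
    (hF : IsStoppingFunction B a b F) :
    (T.numLeaves : ℝ≥0∞) ≤ max 1 (∫⁻ x in Set.Icc a b, 2 / F x) := by
  by_cases hT : T = .leaf
  · subst hT; simp [SubdivisionTree.numLeaves]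
  · exact le_max_of_le_right ((T.numLeaves_le_of_ne_leaf hT hab h hF).trans
      (lintegral_mono_set Set.Ioc_subset_Icc_self))

/-- Induction on the number of halvings that bring the width below `δ`. -/
theorem exists_isTreeOf {B : ℝ → ℝ → Prop} {a b δ : ℝ} (hab : a ≤ b) (hδ : 0 < δ)
    (h : ∀ c e, a ≤ c → c ≤ e → e ≤ b → e - c < δ → B c e) :
    ∃ T : SubdivisionTree, T.IsTreeOf B a b := by
  have main : ∀ (n : ℕ) (c e : ℝ), a ≤ c → c ≤ e → e ≤ b → e - c < δ * 2 ^ n →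
      ∃ T : SubdivisionTree, T.IsTreeOf B c e := by
    intro n
    induction n with
    | zero => exact fun c e h1 h2 h3 h4 => ⟨.leaf, h c e h1 h2 h3 (by simpa using h4)⟩
    | succ n ih =>
      intro c e h1 h2 h3 h4
      by_cases hB : B c e
      · exact ⟨.leaf, hB⟩
      · rw [pow_succ] at h4
        obtain ⟨l, hl⟩ := ih c ((c + e) / 2) h1 (by linarith) (by linarith) (by linarith)
        obtain ⟨r, hr⟩ := ih ((c + e) / 2) e (by linarith) (by linarith) h3 (by linarith)
        exact ⟨.node l r, hB, hl, hr⟩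
  obtain ⟨n, hn⟩ := pow_unbounded_of_one_lt ((b - a) / δ) one_lt_two
  exact main n a b le_rfl hab le_rfl (by rwa [div_lt_iff₀' hδ] at hn)

end Trees

/-! ### Second distance and consecutive roots -/

section SecondDistance

theorem dist₂_le {x α β : ℝ} {S : Set ℝ} (hα : α ∈ S) (hβ : β ∈ S) (h : α ≠ β) :
    dist₂ x S ≤ max (edist x α) (edist x β) :=
  (iInf₂_le α hα).trans ((iInf₂_le β hβ).trans (iInf_le _ h))

theorem le_dist₂ {x : ℝ} {S : Set ℝ} {c : ℝ≥0∞}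
    (h : ∀ α ∈ S, ∀ β ∈ S, α ≠ β → c ≤ max (edist x α) (edist x β)) : c ≤ dist₂ x S :=
  le_iInf₂ fun α hα => le_iInf₂ fun β hβ => le_iInf fun hne => h α hα β hβ hne

theorem exists_ofReal_lt_dist₂ {S : Set ℝ} (hS : S.Finite) :
    ∃ δ : ℝ, 0 < δ ∧ ∀ x, ENNReal.ofReal δ ≤ dist₂ x S := by
  obtain ⟨δ, hδ, h⟩ : ∃ δ : ℝ, 0 < δ ∧ ENNReal.ofReal δ ≤ S.einfsep := by
    have : Finite S := hS.to_subtype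
    have hpos : 0 < S.einfsep := Set.einfsep_pos_of_finite
    -- The separation is infinite for fewer than two points, so a finite value below it is chosen.
    obtain ⟨r, hr0, hr⟩ := ENNReal.lt_iff_exists_real_btwn.mp hpos
    exact ⟨r, by simpa using hr.1, hr.2.le⟩
  refine ⟨δ / 2, by linarith, fun x => le_dist₂ fun α hα β hβ hne => ?_⟩
  have h1 : ENNReal.ofReal δ ≤ edist α β := h.trans (Set.einfsep_le_edist_of_mem hα hβ hne)
  rw [edist_dist, ENNReal.ofReal_le_ofReal_iff dist_nonneg] at h1
  rw [edist_dist, edist_dist, le_max_iff, ENNReal.ofReal_le_ofReal_iff dist_nonneg,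
    ENNReal.ofReal_le_ofReal_iff dist_nonneg]
  by_contra! hlt
  linarith [dist_triangle_left α β x]

theorem isStoppingFunction_dist₂ {B : ℝ → ℝ → Prop} {S : Set ℝ} (a b : ℝ)
    (hB : ∀ c e, c ≤ e → (∀ α ∈ Set.Icc c e, ∀ β ∈ Set.Icc c e, α ∈ S → β ∈ S → α = β) →
      B c e) :
    IsStoppingFunction B a b (fun x => dist₂ x S) := by
  intro x c e _ _ hx hlt
  refine hB c e (hx.1.trans hx.2) fun α hα β hβ hαS hβS => ?_
  by_contra hne
  refine hlt.not_ge ((dist₂_le hαS hβS hne).trans (max_le ?_ ?_)) <;>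
  · rw [edist_dist]
    exact ENNReal.ofReal_le_ofReal (Real.dist_le_of_mem_Icc hx (by assumption))

theorem exists_succ (R : Finset ℝ) : ∃ s : ℝ → ℝ, ∀ α ∈ R, (∃ β ∈ R, α < β) →
    s α ∈ R ∧ α < s α ∧ ∀ β ∈ R, α < β → s α ≤ β := by
  have : ∀ α : ℝ, ∃ σ : ℝ, α ∈ R → (∃ β ∈ R, α < β) →
      σ ∈ R ∧ α < σ ∧ ∀ β ∈ R, α < β → σ ≤ β := by
    intro α
    by_cases h : ∃ β ∈ R, α < β
    · obtain ⟨β, hβ, hlt⟩ := h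
      have hne : (R.filter (fun β => α < β)).Nonempty := ⟨β, by simp [hβ, hlt]⟩
      obtain ⟨σ, hσ, hmin⟩ := Finset.exists_min_image _ id hne
      rw [Finset.mem_filter] at hσ
      exact ⟨σ, fun _ _ => ⟨hσ.1, hσ.2, fun β hβ hlt => hmin β (by simp [hβ, hlt])⟩⟩
    -- No larger point exists, so the value is arbitrary.
    · exact ⟨0, fun _ h' => absurd h' h⟩
  choose s hs using this
  exact ⟨s, hs⟩

/-- The points of a finite set of reals which are not its maximum. -/
noncomputable def nonmax (R : Finset ℝ) : Finset ℝ :=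
  open Classical in R.filter (fun α => ∃ β ∈ R, α < β)

theorem mem_nonmax {R : Finset ℝ} {α : ℝ} : α ∈ nonmax R ↔ α ∈ R ∧ ∃ β ∈ R, α < β := by
  classical
  simp [nonmax]

/-- `s` maps every point of `R` but the largest to the next larger point of `R`. -/
def IsSucc (R : Finset ℝ) (s : ℝ → ℝ) : Prop :=
  ∀ α ∈ nonmax R, s α ∈ R ∧ α < s α ∧ ∀ β ∈ R, α < β → s α ≤ β

theorem exists_isSucc (R : Finset ℝ) : ∃ s, IsSucc R s := by
  obtain ⟨s, hs⟩ := exists_succ R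
  exact ⟨s, fun α hα => hs α (mem_nonmax.mp hα).1 (mem_nonmax.mp hα).2⟩

theorem IsSucc.injOn {R : Finset ℝ} {s : ℝ → ℝ} (hs : IsSucc R s) :
    Set.InjOn s (nonmax R) := by
  have hlt : ∀ α ∈ nonmax R, ∀ β ∈ nonmax R, α < β → s α < s β := fun α hα β hβ h =>
    ((hs α hα).2.2 β (mem_nonmax.mp hβ).1 h).trans_lt (hs β hβ).2.1
  intro α hα β hβ h
  by_contra hne
  rcases lt_or_gt_of_ne hne with h' | h'
  · exact (hlt α hα β hβ h').ne h
  · exact (hlt β hβ α hα h').ne' h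

/-- Lets consecutive pairs alone compute the second distance. Take `γ` largest in `[α, β)` among `α`
and the points up to `x`. Then `γ` is `α` or lies between `α` and `x`, and its successor is `β` or
lies between `x` and `β`. -/
theorem IsSucc.exists_max_le {R : Finset ℝ} {s : ℝ → ℝ} (hs : IsSucc R s) {α β : ℝ}
    (hα : α ∈ R) (hβ : β ∈ R) (hαβ : α < β) (x : ℝ) :
    ∃ γ ∈ nonmax R, max |x - γ| |x - s γ| ≤ max |x - α| |x - β| := by
  classical
  let T := R.filter (fun γ => (α ≤ γ ∧ γ < β) ∧ (γ = α ∨ γ ≤ x))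
  obtain ⟨γ, hγT, hmax⟩ := Finset.exists_max_image T id ⟨α, by simp [T, hα, hαβ]⟩
  simp only [T, Finset.mem_filter, id] at hγT hmax
  obtain ⟨hγR, ⟨hαγ, hγβ⟩, hγx⟩ := hγT
  have hγ : γ ∈ nonmax R := mem_nonmax.mpr ⟨hγR, β, hβ, hγβ⟩
  obtain ⟨h1, h2, h3⟩ := hs γ hγ
  have hsβ := h3 β hβ hγβ
  refine ⟨γ, hγ, max_le_max ?_ ?_⟩
  · rcases hγx with rfl | hγx
    · exact le_rfl
    · rw [abs_of_nonneg (by linarith), abs_of_nonneg (by linarith)]; linarith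
  · rcases hsβ.eq_or_lt with h | h
    · rw [h]
    · have hx : x < s γ := by
        by_contra hle
        have := hmax (s γ) ⟨h1, ⟨by linarith, h⟩, Or.inr (not_lt.mp hle)⟩
        linarith
      rw [abs_of_nonpos (by linarith), abs_of_nonpos (by linarith)]; linarith

/-- Puts the distance to the farther root into a form that is easy to integrate. -/
theorem max_abs_sub_eq {x α β : ℝ} (h : α ≤ β) :
    max |x - α| |x - β| = |x - (α + β) / 2| + (β - α) / 2 := by
  rcases le_total x ((α + β) / 2) with h1 | h1
  · rw [abs_of_nonpos (show x - (α + β) / 2 ≤ 0 by linarith),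
      abs_of_nonpos (show x - β ≤ 0 by linarith), max_eq_right]
    · ring
    · exact abs_le.mpr ⟨by linarith, by linarith⟩
  · rw [abs_of_nonneg (show 0 ≤ x - (α + β) / 2 by linarith),
      abs_of_nonneg (show 0 ≤ x - α by linarith), max_eq_left]
    · ring
    · exact abs_le.mpr ⟨by linarith, by linarith⟩

/-- The largest reciprocal over consecutive pairs is replaced by the sum of all. With fewer than two
points the sum is empty and the distance infinite, so both sides vanish. -/
theorem IsSucc.two_div_dist₂_le {R : Finset ℝ} {s : ℝ → ℝ} (hs : IsSucc R s) (x : ℝ) :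
    2 / dist₂ x R ≤ ∑ α ∈ nonmax R,
      ENNReal.ofReal (2 / (|x - (α + s α) / 2| + (s α - α) / 2)) := by
  set f : ℝ → ℝ := fun α => |x - (α + s α) / 2| + (s α - α) / 2 with hf
  have hfpos : ∀ α ∈ nonmax R, 0 < f α := fun α hα => by
    have := (hs α hα).2.1
    have := abs_nonneg (x - (α + s α) / 2)
    simp only [hf]; linarith
  have hinv : (dist₂ x R)⁻¹ ≤ ∑ α ∈ nonmax R, ENNReal.ofReal (f α)⁻¹ := by
    rw [ENNReal.inv_le_iff_inv_le]
    refine le_dist₂ ?_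
    have key : ∀ α ∈ R, ∀ β ∈ R, α < β →
        (∑ α ∈ nonmax R, ENNReal.ofReal (f α)⁻¹)⁻¹ ≤ max (edist x α) (edist x β) := by
      intro α hα β hβ hlt
      obtain ⟨γ, hγ, hle⟩ := hs.exists_max_le hα hβ hlt x
      rw [max_abs_sub_eq (hs γ hγ).2.1.le] at hle
      calc (∑ α ∈ nonmax R, ENNReal.ofReal (f α)⁻¹)⁻¹
          ≤ (ENNReal.ofReal (f γ)⁻¹)⁻¹ := ENNReal.inv_le_inv.mpr
            (Finset.single_le_sum (f := fun α => ENNReal.ofReal (f α)⁻¹)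
              (fun _ _ => zero_le) hγ)
        _ = ENNReal.ofReal (f γ) := by
            rw [ENNReal.ofReal_inv_of_pos (hfpos γ hγ), inv_inv]
        _ ≤ ENNReal.ofReal (max |x - α| |x - β|) := ENNReal.ofReal_le_ofReal hle
        _ = max (edist x α) (edist x β) := by
            rw [edist_dist, edist_dist, Real.dist_eq, Real.dist_eq, ENNReal.ofReal_max]
    intro α hα β hβ hne
    rcases lt_or_gt_of_ne hne with h | h
    · exact key α hα β hβ h
    · rw [max_comm]; exact key β hβ α hα h
  rw [ENNReal.div_eq_inv_mul, mul_comm]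
  refine (mul_le_mul_right hinv 2).trans_eq ?_
  rw [Finset.mul_sum]
  refine Finset.sum_congr rfl fun α _ => ?_
  rw [div_eq_mul_inv, ENNReal.ofReal_mul zero_le_two]
  simp [hf]

end SecondDistance

/-! ### The integral for one pair of roots -/

section Integral

theorem integral_two_div_abs_add {h r : ℝ} (hh : 0 < h) (hr : 0 ≤ r) :
    ∫ u in (-r)..r, 2 / (|u| + h) = 4 * Real.log ((r + h) / h) := by
  have hcont : Continuous fun u : ℝ => 2 / (|u| + h) :=
    continuous_const.div (continuous_abs.add continuous_const)
      fun u => by have := abs_nonneg u; positivity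
  rw [← intervalIntegral.integral_add_adjacent_intervals (b := 0)
    (hcont.intervalIntegrable _ _) (hcont.intervalIntegrable _ _)]
  have h1 : ∫ u in (-r)..0, 2 / (|u| + h) = ∫ u in (0 : ℝ)..r, 2 / (|u| + h) := by
    have := intervalIntegral.integral_comp_neg (a := 0) (b := r) fun u : ℝ => 2 / (|u| + h)
    simpa using this.symm
  have h2 : ∫ u in (0 : ℝ)..r, 2 / (|u| + h) = 2 * Real.log ((r + h) / h) := by
    have : ∫ u in (0 : ℝ)..r, 2 / (|u| + h) = ∫ u in (0 : ℝ)..r, 2 * (u + h)⁻¹ := by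
      refine intervalIntegral.integral_congr fun u hu => ?_
      rw [Set.uIcc_of_le hr] at hu
      simp only [abs_of_nonneg hu.1, div_eq_mul_inv]
    rw [this, intervalIntegral.integral_const_mul,
      intervalIntegral.integral_comp_add_right (fun u : ℝ => u⁻¹),
      integral_inv_of_pos (by linarith) (by linarith), zero_add]
  rw [h1, h2]; ring

theorem setLIntegral_two_div_abs_add_le {a b m h r : ℝ} (hh : 0 < h) (hr : 0 ≤ r)
    (ha : m - r ≤ a) (hb : b ≤ m + r) :
    ∫⁻ x in Set.Icc a b, ENNReal.ofReal (2 / (|x - m| + h)) ≤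
      ENNReal.ofReal (4 * Real.log ((r + h) / h)) := by
  have hcont : Continuous fun x : ℝ => 2 / (|x - m| + h) :=
    continuous_const.div ((continuous_id.sub continuous_const).abs.add continuous_const)
      fun x => by have := abs_nonneg (x - m); positivity
  calc _ ≤ ∫⁻ x in Set.Icc (m - r) (m + r), ENNReal.ofReal (2 / (|x - m| + h)) :=
        lintegral_mono_set (Set.Icc_subset_Icc ha hb)
    _ = ENNReal.ofReal (∫ x in Set.Icc (m - r) (m + r), 2 / (|x - m| + h)) := by
        rw [ofReal_integral_eq_lintegral_ofReal hcont.continuousOn.integrableOn_Icc]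
        exact Filter.Eventually.of_forall fun x => by
          have := abs_nonneg (x - m); positivity
    _ = _ := by
        rw [integral_Icc_eq_integral_Ioc, ← intervalIntegral.integral_of_le (by linarith),
          intervalIntegral.integral_comp_sub_right (fun u => 2 / (|u| + h)),
          ← integral_two_div_abs_add hh hr]
        congr 2 <;> ring

end Integral

end SturmBisection

namespace SturmBisection

open Polynomial Real

/-! ### Crude bounds on polynomial values -/

section EvalBounds

variable {K : Type*} [NormedField K]

theorem norm_eval_le {q : K[X]} {n : ℕ} {B : ℝ} (hn : q.natDegree ≤ n)
    (hB : ∀ i, ‖q.coeff i‖ ≤ B) (z : K) :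
    ‖q.eval z‖ ≤ (n + 1) * B * max 1 ‖z‖ ^ n := by
  have hB0 : 0 ≤ B := (norm_nonneg _).trans (hB 0)
  rw [eval_eq_sum_range' (Nat.lt_succ_of_le hn)]
  calc _ ≤ ∑ i ∈ Finset.range (n + 1), ‖q.coeff i * z ^ i‖ := norm_sum_le _ _
    _ ≤ ∑ i ∈ Finset.range (n + 1), B * max 1 ‖z‖ ^ n := by
        refine Finset.sum_le_sum fun i hi => ?_
        rw [norm_mul, norm_pow]
        refine mul_le_mul (hB i) ?_ (by positivity) hB0
        calc ‖z‖ ^ i ≤ max 1 ‖z‖ ^ i := by gcongr; exact le_max_right _ _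
          _ ≤ max 1 ‖z‖ ^ n :=
            pow_le_pow_right₀ (le_max_left _ _) (Nat.lt_succ_iff.mp (Finset.mem_range.mp hi))
    _ = _ := by simp [mul_assoc]

theorem norm_coeff_derivative_le [NormedAlgebra ℝ K] {q : K[X]} {n : ℕ} {B : ℝ}
    (hn : q.natDegree ≤ n) (hB : ∀ i, ‖q.coeff i‖ ≤ B) (i : ℕ) :
    ‖(derivative q).coeff i‖ ≤ n * B := by
  have hB0 : 0 ≤ B := (norm_nonneg _).trans (hB 0)
  rw [coeff_derivative]
  rcases le_or_gt (i + 1) n with h | h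
  · have h1 : ‖((i : K) + 1)‖ = (i : ℝ) + 1 := by
      have := norm_algebraMap' K ((i : ℝ) + 1)
      rw [map_add, map_natCast, map_one] at this
      rw [this, Real.norm_of_nonneg (by positivity)]
    rw [norm_mul, h1, mul_comm]
    exact mul_le_mul (by exact_mod_cast h) (hB _) (norm_nonneg _) (by positivity)
  · rw [coeff_eq_zero_of_natDegree_lt (by omega), zero_mul, norm_zero]
    positivity

end EvalBounds

/-! ### Root sizes, the resultant, and derivatives at roots -/

section IntegerPolynomial

variable {p : ℤ[X]}

/-- Over the perfect field ℚ squarefree means separable, and separability survives field extension.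
-/
theorem separable_map {K : Type*} [Field K] [CharZero K]
    (h : Squarefree (p.map (Int.castRingHom ℚ))) : (p.map (Int.castRingHom K)).Separable := by
  have h1 := PerfectField.separable_iff_squarefree.mpr h
  have h2 := h1.map (f := Rat.castHom K)
  rwa [map_map, RingHom.ext_int ((Rat.castHom K).comp (Int.castRingHom ℚ)) (Int.castRingHom K)]
    at h2

theorem natDegree_map_int (K : Type*) [Field K] [CharZero K] :
    (p.map (Int.castRingHom K)).natDegree = p.natDegree :=
  natDegree_map_eq_of_injective (RingHom.injective_int _) p

theorem norm_coeff_map_le {K : Type*} [NormedField K] [NormedAlgebra ℝ K] {L : ℕ}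
    (hp : ∀ i, |p.coeff i| < 2 ^ L) (i : ℕ) :
    ‖(p.map (Int.castRingHom K)).coeff i‖ ≤ 2 ^ L := by
  rw [coeff_map, eq_intCast, ← map_intCast (algebraMap ℝ K), norm_algebraMap', Real.norm_eq_abs]
  exact_mod_cast (hp i).le

theorem one_le_of_abs_coeff_lt {L : ℕ} (h0 : p ≠ 0) (hp : ∀ i, |p.coeff i| < 2 ^ L) : 1 ≤ L := by
  have h1 := hp p.natDegree
  have h2 := Int.one_le_abs (leadingCoeff_ne_zero.mpr h0)
  rcases Nat.eq_zero_or_pos L with rfl | h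
  · rw [pow_zero] at h1; exact absurd h1 h2.not_gt
  · exact h

theorem one_le_norm_leadingCoeff (h0 : p ≠ 0) :
    1 ≤ ‖(p.map (Int.castRingHom ℂ)).leadingCoeff‖ := by
  rw [leadingCoeff_map_of_injective (RingHom.injective_int _), eq_intCast, Complex.norm_intCast]
  exact_mod_cast Int.one_le_abs (leadingCoeff_ne_zero.mpr h0)

/-- The Mahler measure is at most the sum of the absolute values of the coefficients, and the
leading coefficient has absolute value at least 1. -/
theorem sum_posLog_roots_le {L : ℕ} (h0 : p ≠ 0)
    (hsep : (p.map (Int.castRingHom ℂ)).Separable) (hp : ∀ i, |p.coeff i| < 2 ^ L) :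
    ∑ z ∈ (p.map (Int.castRingHom ℂ)).roots.toFinset, log⁺ ‖z‖ ≤
      log ((p.natDegree + 1) * 2 ^ L) := by
  set q := p.map (Int.castRingHom ℂ) with hq
  have h1 : ∑ z ∈ q.roots.toFinset, log⁺ ‖z‖ = (q.roots.map (fun a ↦ log⁺ ‖a‖)).sum := by
    rw [Finset.sum, Multiset.toFinset_val, (nodup_roots hsep).dedup]
  have h2 := logMahlerMeasure_eq_log_leadingCoeff_add_sum_log_roots q
  rw [logMahlerMeasure_eq_log_MahlerMeasure] at h2
  have h3 : 0 ≤ log ‖q.leadingCoeff‖ := log_nonneg (one_le_norm_leadingCoeff h0)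
  have h4 : q.mahlerMeasure ≤ (p.natDegree + 1) * 2 ^ L := by
    refine (mahlerMeasure_le_sum_norm_coeff q).trans ?_
    rw [sum_over_range _ (by simp), hq, natDegree_map_int]
    refine (Finset.sum_le_sum fun i _ => norm_coeff_map_le hp i).trans_eq ?_
    simp
  have h5 : log q.mahlerMeasure ≤ log ((p.natDegree + 1) * 2 ^ L) :=
    log_le_log (mahlerMeasure_pos_of_ne_zero hsep.ne_zero) h4
  linarith

theorem eval_derivative_ne_zero {K : Type*} [Field K] {q : K[X]} (hq : q.Separable) {z : K}
    (hz : q.eval z = 0) : (derivative q).eval z ≠ 0 := by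
  intro h1
  obtain ⟨a, b, hab⟩ := hq
  have := congrArg (eval z) hab
  simp [hz, h1] at this

/-- The discriminant of a separable integer polynomial has absolute value at least one. -/
theorem zero_le_log_leadingCoeff_add_sum (hsep : (p.map (Int.castRingHom ℂ)).Separable) :
    0 ≤ (p.natDegree : ℝ) * log ‖(p.map (Int.castRingHom ℂ)).leadingCoeff‖ +
      ∑ z ∈ (p.map (Int.castRingHom ℂ)).roots.toFinset,
        log ‖(derivative (p.map (Int.castRingHom ℂ))).eval z‖ := by
  set q := p.map (Int.castRingHom ℂ) with hq
  have hdeg : (derivative q).natDegree ≤ p.natDegree :=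
    (natDegree_derivative_le q).trans ((Nat.sub_le _ _).trans (natDegree_map_int ℂ).le)
  have hq0 : q ≠ 0 := hsep.ne_zero
  have hlc : q.leadingCoeff ≠ 0 := leadingCoeff_ne_zero.mpr hq0
  -- `p'` is given formal degree `p.natDegree`, one more than its degree; this costs only one
  -- further factor of the leading coefficient.
  have hprod := resultant_eq_prod_eval q (derivative q) p.natDegree hdeg
    (IsAlgClosed.splits q)
  have hint : resultant q (derivative q) q.natDegree p.natDegree =
      Int.castRingHom ℂ (resultant p (derivative p) q.natDegree p.natDegree) := by
    rw [← resultant_map_map, derivative_map]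
  have hmul : (q.roots.map (derivative q).eval).prod =
      ∏ z ∈ q.roots.toFinset, (derivative q).eval z := by
    rw [Finset.prod, Multiset.toFinset_val, (nodup_roots hsep).dedup]
  rw [hmul] at hprod
  have hne : ∀ z ∈ q.roots.toFinset, (derivative q).eval z ≠ 0 := fun z hz => by
    rw [Multiset.mem_toFinset, mem_roots hq0] at hz
    exact eval_derivative_ne_zero hsep hz
  -- The left factor and the product form the image of an integer resultant, nonzero because the
  -- roots are simple.
  have hres : 1 ≤ ‖q.leadingCoeff ^ p.natDegree *
      ∏ z ∈ q.roots.toFinset, (derivative q).eval z‖ := by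
    have hne' : q.leadingCoeff ^ p.natDegree *
      ∏ z ∈ q.roots.toFinset, (derivative q).eval z ≠ 0 :=
      mul_ne_zero (pow_ne_zero _ hlc) (Finset.prod_ne_zero_iff.mpr hne)
    rw [← hprod, hint, eq_intCast] at hne' ⊢
    rw [Complex.norm_intCast]
    exact_mod_cast Int.one_le_abs (by exact_mod_cast hne')
  have := log_nonneg hres
  rwa [norm_mul, norm_pow, norm_prod, log_mul, log_pow, log_prod] at this
  · exact fun z hz => norm_ne_zero_iff.mpr (hne z hz)
  · exact pow_ne_zero _ (norm_ne_zero_iff.mpr hlc)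
  · exact Finset.prod_ne_zero_iff.mpr fun z hz => norm_ne_zero_iff.mpr (hne z hz)

theorem log_norm_eval_derivative_le {L : ℕ} (hd : 1 ≤ p.natDegree)
    (hp : ∀ i, |p.coeff i| < 2 ^ L) {z : ℂ}
    (hz : (derivative (p.map (Int.castRingHom ℂ))).eval z ≠ 0) :
    log ‖(derivative (p.map (Int.castRingHom ℂ))).eval z‖ ≤
      log ((p.natDegree + 1) * (p.natDegree * 2 ^ L)) + p.natDegree * log⁺ ‖z‖ := by
  have hd' : (1 : ℝ) ≤ p.natDegree := by exact_mod_cast hd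
  have h := norm_eval_le (q := derivative (p.map (Int.castRingHom ℂ))) (n := p.natDegree)
    ((natDegree_derivative_le _).trans ((Nat.sub_le _ _).trans (natDegree_map_int ℂ).le))
    (norm_coeff_derivative_le (natDegree_map_int ℂ).le (norm_coeff_map_le hp)) z
  refine (log_le_log (norm_pos_iff.mpr hz) h).trans_eq ?_
  rw [log_mul (by positivity) (by positivity), log_pow, posLog_eq_log_max_one (norm_nonneg _)]

/-- The derivative at a root is bounded by the distance to the next root. -/
theorem log_abs_eval_derivative_le {L : ℕ} (hd : 1 ≤ p.natDegree)
    (hp : ∀ i, |p.coeff i| < 2 ^ L) {α β : ℝ} (hαβ : α < β)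
    (hα : (p.map (Int.castRingHom ℝ)).eval α = 0) (hβ : (p.map (Int.castRingHom ℝ)).eval β = 0)
    (hα' : (derivative (p.map (Int.castRingHom ℝ))).eval α ≠ 0) :
    log |(derivative (p.map (Int.castRingHom ℝ))).eval α| ≤
      log (β - α) + log ((p.natDegree + 1) * (p.natDegree * (p.natDegree * 2 ^ L))) +
        p.natDegree * (log⁺ |α| + log⁺ |β|) := by
  set q := p.map (Int.castRingHom ℝ) with hq
  have hd' : (1 : ℝ) ≤ p.natDegree := by exact_mod_cast hd
  have hdeg : q.natDegree ≤ p.natDegree := (natDegree_map_int ℝ).le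
  have hdeg1 : (derivative q).natDegree ≤ p.natDegree :=
    (natDegree_derivative_le q).trans ((Nat.sub_le _ _).trans hdeg)
  have hdeg2 : (derivative (derivative q)).natDegree ≤ p.natDegree :=
    (natDegree_derivative_le _).trans ((Nat.sub_le _ _).trans hdeg1)
  have hcoeff := norm_coeff_derivative_le hdeg1
    (norm_coeff_derivative_le hdeg (norm_coeff_map_le hp))
  -- By Rolle `p'` vanishes at some `ξ` between the roots, so the mean value inequality on `p'` from
  -- `α` to `ξ` bounds `|p'(α)|` by the gap times `D`.
  obtain ⟨ξ, hξ, hξ0⟩ := exists_hasDerivAt_eq_zero hαβ q.continuous.continuousOn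
    (hα.trans hβ.symm) (fun x _ => q.hasDerivAt x)
  -- The product of the two maxima dominates `max 1 |x|` on the whole interval, and its logarithm
  -- splits into `log⁺` terms.
  set D : ℝ := (p.natDegree + 1) * (p.natDegree * (p.natDegree * 2 ^ L)) *
    (max 1 |α| * max 1 |β|) ^ p.natDegree with hD
  have hmax : ∀ x ∈ Set.Icc α β, max 1 ‖x‖ ≤ max 1 |α| * max 1 |β| := by
    intro x hx
    have hx' : |x| ≤ max |α| |β| := abs_le_max_abs_abs hx.1 hx.2
    have h1 := le_max_left 1 |α|
    have h2 := le_max_left 1 |β|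
    have h3 : max 1 |α| ≤ max 1 |α| * max 1 |β| := le_mul_of_one_le_right (by linarith) h2
    have h4 : max 1 |β| ≤ max 1 |α| * max 1 |β| := le_mul_of_one_le_left (by linarith) h1
    refine max_le (h1.trans h3) (hx'.trans (max_le ?_ ?_))
    · exact (le_max_right _ _).trans h3
    · exact (le_max_right _ _).trans h4
  have hbound : ∀ x ∈ Set.Icc α β, ‖(derivative (derivative q)).eval x‖ ≤ D := by
    intro x hx
    refine (norm_eval_le hdeg2 hcoeff x).trans ?_
    rw [hD]
    gcongr
    exact hmax x hx
  have hmvt := (convex_Icc α β).norm_image_sub_le_of_norm_hasDerivWithin_le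
    (f := fun x => (derivative q).eval x) (fun x _ => ((derivative q).hasDerivAt x).hasDerivWithinAt)
    hbound (Set.Ioo_subset_Icc_self hξ) (Set.left_mem_Icc.mpr hαβ.le)
  have h1 : |(derivative q).eval α| ≤ (β - α) * D := by
    rw [hξ0, sub_zero, Real.norm_eq_abs, Real.norm_eq_abs] at hmvt
    refine hmvt.trans ?_
    rw [mul_comm]
    have hD0 : 0 ≤ D := by positivity
    refine mul_le_mul_of_nonneg_right ?_ hD0
    rw [abs_of_nonpos (by linarith [hξ.1])]
    linarith [hξ.2]
  refine (log_le_log (abs_pos.mpr hα') h1).trans_eq ?_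
  have hm1 : (0 : ℝ) < max 1 |α| := by positivity
  have hm2 : (0 : ℝ) < max 1 |β| := by positivity
  rw [hD, log_mul (by linarith) (by positivity), log_mul (by positivity) (by positivity), log_pow,
    log_mul hm1.ne' hm2.ne', posLog_eq_log_max_one (abs_nonneg _),
    posLog_eq_log_max_one (abs_nonneg _), add_assoc]

end IntegerPolynomial

/-! ### The product of the gaps -/

section GapProduct

variable {p : ℤ[X]}

theorem ofReal_mem_roots (h0 : p ≠ 0) {α : ℝ}
    (hα : α ∈ (p.map (Int.castRingHom ℝ)).roots.toFinset) :
    (α : ℂ) ∈ (p.map (Int.castRingHom ℂ)).roots.toFinset := by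
  have hinj : ∀ (K : Type) [Field K] [CharZero K], p.map (Int.castRingHom K) ≠ 0 :=
    fun K _ _ => (Polynomial.map_ne_zero_iff (RingHom.injective_int _)).mpr h0
  rw [Multiset.mem_toFinset, mem_roots (hinj ℝ), IsRoot, eval_map,
    eval₂_eq_eval_map] at hα
  rw [Multiset.mem_toFinset, mem_roots (hinj ℂ), IsRoot]
  have : p.map (Int.castRingHom ℂ) = (p.map (Int.castRingHom ℝ)).map Complex.ofRealHom := by
    rw [map_map]; congr 1
  rw [this, eval_map, ← Complex.ofRealHom_eq_coe, eval₂_at_apply, hα, map_zero]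

theorem eval_derivative_ofReal (α : ℝ) :
    (derivative (p.map (Int.castRingHom ℂ))).eval (α : ℂ) =
      (((derivative (p.map (Int.castRingHom ℝ))).eval α : ℝ) : ℂ) := by
  have : p.map (Int.castRingHom ℂ) = (p.map (Int.castRingHom ℝ)).map Complex.ofRealHom := by
    rw [map_map]; congr 1
  rw [this, derivative_map, eval_map, ← Complex.ofRealHom_eq_coe, eval₂_at_apply,
    Complex.ofRealHom_eq_coe]

/-- Injectivity ensures that each root is counted at most once. Used with `f` the identity and the
successor map. -/
theorem sum_posLog_comp_le {L : ℕ} (h0 : p ≠ 0)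
    (hsep : (p.map (Int.castRingHom ℂ)).Separable) (hp : ∀ i, |p.coeff i| < 2 ^ L)
    {T : Finset ℝ} {f : ℝ → ℝ} (hf : Set.InjOn f T)
    (hfT : ∀ α ∈ T, f α ∈ (p.map (Int.castRingHom ℝ)).roots.toFinset) :
    ∑ α ∈ T, log⁺ |f α| ≤ log ((p.natDegree + 1) * 2 ^ L) := by
  classical
  refine le_trans ?_ (sum_posLog_roots_le h0 hsep hp)
  have hinj : Set.InjOn (fun α => ((f α : ℝ) : ℂ)) T :=
    fun a ha b hb h => hf ha hb (Complex.ofReal_injective h)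
  calc ∑ α ∈ T, log⁺ |f α| = ∑ z ∈ T.image (fun α => ((f α : ℝ) : ℂ)), log⁺ ‖z‖ := by
        rw [Finset.sum_image hinj]; simp
    _ ≤ _ := by
        refine Finset.sum_le_sum_of_subset_of_nonneg ?_ fun _ _ _ => posLog_nonneg
        intro z hz
        obtain ⟨α, hα, rfl⟩ := Finset.mem_image.mp hz
        exact ofReal_mem_roots h0 (hfT α hα)

/-- A lower bound of Davenport–Mahler type for the product of the gaps between consecutive real
roots of an integer polynomial, in logarithmic form. -/
theorem IsSucc.neg_sum_log_gap_le {L : ℕ} (hd : 1 ≤ p.natDegree)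
    (hsq : Squarefree (p.map (Int.castRingHom ℚ))) (hp : ∀ i, |p.coeff i| < 2 ^ L)
    {s : ℝ → ℝ} (hs : IsSucc (p.map (Int.castRingHom ℝ)).roots.toFinset s) :
    ∑ α ∈ nonmax (p.map (Int.castRingHom ℝ)).roots.toFinset, -log (s α - α) ≤
      14 * (p.natDegree * (L + log p.natDegree)) := by
  classical
  have h0 : p ≠ 0 := by rintro rfl; simp at hd
  have hL : (1 : ℝ) ≤ L := by exact_mod_cast one_le_of_abs_coeff_lt h0 hp
  have hsepR := separable_map (K := ℝ) hsq
  have hsepC := separable_map (K := ℂ) hsq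
  set d : ℝ := (p.natDegree : ℝ) with hd_def
  have hd' : (1 : ℝ) ≤ d := by rw [hd_def]; exact_mod_cast hd
  set R := (p.map (Int.castRingHom ℝ)).roots.toFinset with hR
  set Z := (p.map (Int.castRingHom ℂ)).roots.toFinset with hZ
  have hRroot : ∀ α ∈ R, (p.map (Int.castRingHom ℝ)).eval α = 0 := fun α hα => by
    rwa [hR, Multiset.mem_toFinset, mem_roots hsepR.ne_zero] at hα
  have hZroot : ∀ z ∈ Z, (p.map (Int.castRingHom ℂ)).eval z = 0 := fun z hz => by
    rwa [hZ, Multiset.mem_toFinset, mem_roots hsepC.ne_zero] at hz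
  have hmemR : ∀ α ∈ nonmax R, α ∈ R := fun α hα => (mem_nonmax.mp hα).1
  -- The resultant sum is split: roots in `N` have a gap to use, the others get the crude bound.
  set N := (nonmax R).image (fun α : ℝ => (α : ℂ)) with hN
  have hNZ : N ⊆ Z := by
    intro z hz
    obtain ⟨α, hα, rfl⟩ := Finset.mem_image.mp hz
    exact ofReal_mem_roots h0 (hmemR α hα)
  have hZcard : (Z.card : ℝ) ≤ d := by
    have h1 : Z.card ≤ p.natDegree := (Multiset.toFinset_card_le _).trans
      ((card_roots' _).trans (natDegree_map_int ℂ).le)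
    rw [hd_def]; exact_mod_cast h1
  have hNcard : N.card = (nonmax R).card :=
    Finset.card_image_of_injective _ Complex.ofReal_injective
  have hNle : ((nonmax R).card : ℝ) ≤ d := by
    rw [← hNcard]; exact le_trans (by exact_mod_cast Finset.card_le_card hNZ) hZcard
  set Λ := log ((d + 1) * 2 ^ L) with hΛ
  set b₁ := log ((d + 1) * (d * 2 ^ L)) with hb₁
  set b₂ := log ((d + 1) * (d * (d * 2 ^ L))) with hb₂
  have hlogd : 0 ≤ log d := log_nonneg hd'
  have hlog2 : log 2 ≤ 1 := (log_le_sub_one_of_pos two_pos).trans (by norm_num)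
  have hL2 : (L : ℝ) * log 2 ≤ L := by nlinarith
  have hΛle : Λ ≤ 2 * (L + log d) := by
    rw [hΛ, log_mul (by positivity) (by positivity), log_pow]
    have : log (d + 1) ≤ log (2 * d) := log_le_log (by positivity) (by linarith)
    rw [log_mul (by positivity) (by positivity)] at this
    linarith
  have hb₁eq : b₁ = Λ + log d := by
    rw [hb₁, hΛ, ← log_mul (by positivity) (by positivity)]; congr 1; ring
  have hb₂eq : b₂ = Λ + 2 * log d := by
    rw [two_mul, ← add_assoc, ← hb₁eq, hb₁, hb₂, ← log_mul (by positivity) (by positivity)]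
    congr 1; ring
  have hb₁0 : 0 ≤ b₁ := by
    rw [hb₁eq, hΛ]
    have : 0 ≤ log ((d + 1) * 2 ^ L) :=
      log_nonneg (one_le_mul_of_one_le_of_one_le (by linarith) (one_le_pow₀ one_le_two))
    linarith
  have hb₂0 : 0 ≤ b₂ := by linarith
  have hlc : log ‖(p.map (Int.castRingHom ℂ)).leadingCoeff‖ ≤ L + log d := by
    have h1 := one_le_norm_leadingCoeff h0
    have h2 : log ‖(p.map (Int.castRingHom ℂ)).leadingCoeff‖ ≤ log (2 ^ L) :=
      log_le_log (by linarith) (norm_coeff_map_le hp _)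
    rw [log_pow] at h2
    linarith
  have hlog_roots := sum_posLog_roots_le h0 hsepC hp
  have hres := zero_le_log_leadingCoeff_add_sum hsepC
  rw [← hZ, ← Finset.sum_sdiff hNZ] at hres
  have hNsum : ∑ z ∈ N, log ‖(derivative (p.map (Int.castRingHom ℂ))).eval z‖ =
      ∑ α ∈ nonmax R, log |(derivative (p.map (Int.castRingHom ℝ))).eval α| := by
    rw [hN, Finset.sum_image Complex.ofReal_injective.injOn]
    refine Finset.sum_congr rfl fun α _ => ?_
    rw [eval_derivative_ofReal, Complex.norm_real, Real.norm_eq_abs]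
  rw [hNsum] at hres
  have hcomp : ∑ z ∈ Z \ N, log ‖(derivative (p.map (Int.castRingHom ℂ))).eval z‖ ≤
      d * b₁ + d * Λ := by
    calc _ ≤ ∑ z ∈ Z \ N, (b₁ + d * log⁺ ‖z‖) := Finset.sum_le_sum fun z hz =>
          log_norm_eval_derivative_le hd hp
            (eval_derivative_ne_zero hsepC (hZroot z (Finset.mem_sdiff.mp hz).1))
      _ ≤ ∑ z ∈ Z, (b₁ + d * log⁺ ‖z‖) :=
          Finset.sum_le_sum_of_subset_of_nonneg Finset.sdiff_subset fun z _ _ => by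
            have := posLog_nonneg (x := ‖z‖)
            positivity
      _ = Z.card * b₁ + d * ∑ z ∈ Z, log⁺ ‖z‖ := by
          rw [Finset.sum_add_distrib, Finset.sum_const, nsmul_eq_mul, Finset.mul_sum]
      _ ≤ d * b₁ + d * Λ := by gcongr
  have hgap : ∑ α ∈ nonmax R, -log (s α - α) ≤
      -∑ α ∈ nonmax R, log |(derivative (p.map (Int.castRingHom ℝ))).eval α| +
        (d * b₂ + 2 * (d * Λ)) := by
    calc _ ≤ ∑ α ∈ nonmax R, (-log |(derivative (p.map (Int.castRingHom ℝ))).eval α| +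
            (b₂ + d * (log⁺ |α| + log⁺ |s α|))) := by
          refine Finset.sum_le_sum fun α hα => ?_
          have hαr := hRroot α (hmemR α hα)
          have := log_abs_eval_derivative_le hd hp (hs α hα).2.1 hαr
            (hRroot _ (hs α hα).1) (eval_derivative_ne_zero hsepR hαr)
          linarith
      _ = -∑ α ∈ nonmax R, log |(derivative (p.map (Int.castRingHom ℝ))).eval α| +
            ((nonmax R).card * b₂ +
              d * (∑ α ∈ nonmax R, log⁺ |α| + ∑ α ∈ nonmax R, log⁺ |s α|)) := by
          rw [Finset.sum_add_distrib, Finset.sum_neg_distrib, Finset.sum_add_distrib,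
            Finset.sum_const, nsmul_eq_mul, ← Finset.mul_sum, Finset.sum_add_distrib]
      _ ≤ -∑ α ∈ nonmax R, log |(derivative (p.map (Int.castRingHom ℝ))).eval α| +
            (d * b₂ + d * (Λ + Λ)) := by
          have e1 := sum_posLog_comp_le h0 hsepC hp (f := fun α => α) (Set.injOn_id _) hmemR
          have e2 := sum_posLog_comp_le h0 hsepC hp hs.injOn fun α hα => (hs α hα).1
          gcongr
      _ = _ := by ring
  -- In units of `d * (L + log d)`: three `Λ` give 6, `b₁` gives 3, `b₂` gives 4, the leading
  -- coefficient 1, in total 14.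
  have f1 : d * Λ ≤ d * (2 * (L + log d)) := by gcongr
  have f2 : d * b₁ ≤ d * (3 * (L + log d)) := by gcongr; linarith
  have f3 : d * b₂ ≤ d * (4 * (L + log d)) := by gcongr; linarith
  have f4 : d * log ‖(p.map (Int.castRingHom ℂ)).leadingCoeff‖ ≤ d * (L + log d) := by gcongr
  linarith

end GapProduct

end SturmBisection

/-! ### The integral bound and the main theorem -/

namespace SturmBisection

open Polynomial Real MeasureTheory

variable {p : ℤ[X]}

theorem realRoots_eq (h0 : p ≠ 0) :
    realRoots p = (p.map (Int.castRingHom ℝ)).roots.toFinset := by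
  ext α
  rw [Finset.mem_coe, Multiset.mem_toFinset,
    mem_roots ((Polynomial.map_ne_zero_iff (RingHom.injective_int _)).mpr h0), IsRoot,
    eval_map, realRoots, Set.mem_ofPred_eq, aeval_def]
  rfl

theorem abs_realRoot_le {L : ℕ} (h0 : p ≠ 0) (hsq : Squarefree (p.map (Int.castRingHom ℚ)))
    (hp : ∀ i, |p.coeff i| < 2 ^ L) {α : ℝ}
    (hα : α ∈ (p.map (Int.castRingHom ℝ)).roots.toFinset) :
    |α| ≤ (p.natDegree + 1) * 2 ^ L := by
  have h := sum_posLog_comp_le h0 (separable_map hsq) hp (T := {α}) (f := fun α => α)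
    (Set.injOn_id _) (by simpa using hα)
  rw [Finset.sum_singleton, posLog_eq_log_max_one (abs_nonneg _),
    log_le_log_iff (by positivity) (by positivity)] at h
  exact (le_max_right _ _).trans h

theorem lintegral_two_div_dist₂_le {L : ℕ} (hd : 1 ≤ p.natDegree)
    (hsq : Squarefree (p.map (Int.castRingHom ℚ))) (hp : ∀ i, |p.coeff i| < 2 ^ L) :
    ∫⁻ x in Set.Icc (-2 ^ L : ℝ) (2 ^ L), 2 / dist₂ x (realRoots p) ≤
      ENNReal.ofReal (72 * (p.natDegree * (L + log p.natDegree))) := by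
  have h0 : p ≠ 0 := by rintro rfl; simp at hd
  have hL : (1 : ℝ) ≤ L := by exact_mod_cast one_le_of_abs_coeff_lt h0 hp
  rw [realRoots_eq h0]
  set R := (p.map (Int.castRingHom ℝ)).roots.toFinset with hR
  obtain ⟨s, hs⟩ := exists_isSucc R
  have hgap := hs.neg_sum_log_gap_le hd hsq hp
  have habs : ∀ α ∈ R, |α| ≤ (p.natDegree + 1) * 2 ^ L := fun α => abs_realRoot_le h0 hsq hp
  have hcard : ((nonmax R).card : ℝ) ≤ p.natDegree := by
    have h1 : nonmax R ⊆ R := fun α hα => (mem_nonmax.mp hα).1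
    have h2 : R.card ≤ p.natDegree := (Multiset.toFinset_card_le _).trans
      ((card_roots' _).trans (natDegree_map_int ℝ).le)
    exact_mod_cast (Finset.card_le_card h1).trans h2
  set d : ℝ := (p.natDegree : ℝ) with hd_def
  have hd' : (1 : ℝ) ≤ d := by rw [hd_def]; exact_mod_cast hd
  set K : ℝ := (d + 1) * 2 ^ L with hK
  have hK2 : (2 : ℝ) ^ L ≤ K := le_mul_of_one_le_left (by positivity) (by linarith)
  have hKpos : 0 < K := by positivity
  have hlogd : 0 ≤ log d := log_nonneg hd'
  have hlog6K : log (6 * K) ≤ 4 * (L + log d) := by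
    have e : log (6 * K) ≤ log (2 ^ 4 * 2 ^ L * d) := by
      refine log_le_log (by positivity) ?_
      rw [hK]
      have : (0 : ℝ) < 2 ^ L := by positivity
      nlinarith
    rw [log_mul (x := 2 ^ 4 * 2 ^ L) (by positivity) (by positivity),
      log_mul (x := 2 ^ 4) (by positivity) (by positivity), log_pow, log_pow] at e
    -- As `1 ≤ L`, the powers of two contribute at most `5 * L * log 2`, which must stay below `4 *
    -- L`; `log 2 ≤ 1` would be too weak.
    have hlog2' : log 2 ≤ 0.6931471808 := log_two_lt_d9.le
    push_cast at e
    nlinarith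
  have hterm : ∀ α ∈ nonmax R, ∫⁻ x in Set.Icc (-2 ^ L : ℝ) (2 ^ L),
      ENNReal.ofReal (2 / (|x - (α + s α) / 2| + (s α - α) / 2)) ≤
        ENNReal.ofReal (4 * (log (6 * K) + -log (s α - α))) := by
    intro α hα
    obtain ⟨h1, h2, -⟩ := hs α hα
    have a1 := abs_le.mp (habs α (mem_nonmax.mp hα).1)
    have a2 := abs_le.mp (habs (s α) h1)
    -- Midpoint and integration range both lie in `[-K, K]`, so radius `2 * K` suffices.
    refine (setLIntegral_two_div_abs_add_le (r := 2 * K) (by linarith) (by linarith)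
      (by linarith) (by linarith)).trans (ENNReal.ofReal_le_ofReal ?_)
    have hg : 0 < s α - α := by linarith
    rw [← sub_eq_add_neg, ← log_div (by positivity) hg.ne']
    have hle : (2 * K + (s α - α) / 2) / ((s α - α) / 2) ≤ 6 * K / (s α - α) := by
      rw [div_le_div_iff₀ (by linarith) hg]
      nlinarith
    have := log_le_log (by positivity) hle
    linarith
  have hnonneg : ∀ α ∈ nonmax R, 0 ≤ 4 * (log (6 * K) + -log (s α - α)) := by
    intro α hα
    obtain ⟨h1, h2, -⟩ := hs α hα
    have a1 := abs_le.mp (habs α (mem_nonmax.mp hα).1)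
    have a2 := abs_le.mp (habs (s α) h1)
    have := log_le_log (show 0 < s α - α by linarith) (show s α - α ≤ 6 * K by linarith)
    linarith
  calc ∫⁻ x in Set.Icc (-2 ^ L : ℝ) (2 ^ L), 2 / dist₂ x R
      ≤ ∫⁻ x in Set.Icc (-2 ^ L : ℝ) (2 ^ L), ∑ α ∈ nonmax R,
          ENNReal.ofReal (2 / (|x - (α + s α) / 2| + (s α - α) / 2)) :=
        lintegral_mono fun x => hs.two_div_dist₂_le x
    _ = ∑ α ∈ nonmax R, ∫⁻ x in Set.Icc (-2 ^ L : ℝ) (2 ^ L),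
          ENNReal.ofReal (2 / (|x - (α + s α) / 2| + (s α - α) / 2)) :=
        lintegral_finsetSum _ fun α _ => by fun_prop
    _ ≤ ∑ α ∈ nonmax R, ENNReal.ofReal (4 * (log (6 * K) + -log (s α - α))) :=
        Finset.sum_le_sum hterm
    _ = ENNReal.ofReal (∑ α ∈ nonmax R, 4 * (log (6 * K) + -log (s α - α))) :=
        (ENNReal.ofReal_sum_of_nonneg hnonneg).symm
    _ ≤ _ := by
        refine ENNReal.ofReal_le_ofReal ?_
        rw [← Finset.mul_sum, Finset.sum_add_distrib, Finset.sum_const, nsmul_eq_mul]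
        have hlog0 : 0 ≤ log (6 * K) :=
          log_nonneg (by linarith [one_le_pow₀ (one_le_two (α := ℝ)) (n := L)])
        -- The constant is `4 * (4 + 14) = 72`.
        have : (nonmax R).card * log (6 * K) ≤ d * (4 * (L + log d)) := by gcongr
        linarith

theorem isStoppingFunction_sturmPred (h0 : p ≠ 0)
    (hsq : Squarefree (p.map (Int.castRingHom ℚ))) (a b : ℝ) :
    IsStoppingFunction (sturmPred p) a b (fun x => dist₂ x (realRoots p)) := by
  refine isStoppingFunction_dist₂ a b fun c e hce h => ?_
  have hsep := separable_map (K := ℝ) hsq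
  refine sturmPredicate_of_subsingleton hsep hce fun α hα β hβ hα0 hβ0 => ?_
  refine h α hα β hβ ?_ ?_ <;>
  · rw [realRoots_eq h0, Finset.mem_coe, Multiset.mem_toFinset, mem_roots hsep.ne_zero]
    assumption

end SturmBisection

theorem mainTheorem3 :
    ∃ C : ℝ, 0 < C ∧ ∀ (d L : ℕ) (p : Polynomial ℤ),
      1 ≤ d → p.natDegree = d →
      Squarefree (p.map (Int.castRingHom ℚ)) →
      (∀ i : ℕ, |p.coeff i| < 2 ^ L) →
      SturmBisection.IsStoppingFunction (SturmBisection.sturmPred p) (-2 ^ L) (2 ^ L)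
          (fun x => SturmBisection.dist₂ x (SturmBisection.realRoots p)) ∧
        ∫⁻ x in Set.Icc (-2 ^ L : ℝ) (2 ^ L),
            2 / SturmBisection.dist₂ x (SturmBisection.realRoots p)
          ≤ ENNReal.ofReal (C * (d * (L + Real.log d))) ∧
        (∃ T : SturmBisection.SubdivisionTree,
          T.IsTreeOf (SturmBisection.sturmPred p) (-2 ^ L) (2 ^ L)) ∧
        ∀ T : SturmBisection.SubdivisionTree,
          T.IsTreeOf (SturmBisection.sturmPred p) (-2 ^ L) (2 ^ L) →
          (T.numLeaves : ENNReal) ≤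
              max 1 (∫⁻ x in Set.Icc (-2 ^ L : ℝ) (2 ^ L),
                2 / SturmBisection.dist₂ x (SturmBisection.realRoots p)) ∧
            (T.size : ℝ) ≤ C * (d * (L + Real.log d)) := by
  -- Twice 72, since the size is below twice the number of leaves.
  refine ⟨144, by norm_num, ?_⟩
  rintro _ L p hd rfl hsq hp
  have h0 : p ≠ 0 := by rintro rfl; simp at hd
  have hL : (1 : ℝ) ≤ L := by exact_mod_cast SturmBisection.one_le_of_abs_coeff_lt h0 hp
  have hd' : (1 : ℝ) ≤ p.natDegree := by exact_mod_cast hd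
  have hlogd := Real.log_nonneg hd'
  have hU : 1 ≤ p.natDegree * (L + Real.log p.natDegree) :=
    one_le_mul_of_one_le_of_one_le hd' (by linarith)
  have hpow : (0 : ℝ) < 2 ^ L := by positivity
  have hI := SturmBisection.lintegral_two_div_dist₂_le hd hsq hp
  have hF := SturmBisection.isStoppingFunction_sturmPred h0 hsq (-2 ^ L) (2 ^ L)
  refine ⟨hF, hI.trans (ENNReal.ofReal_le_ofReal (by linarith)), ?_, fun T hT => ?_⟩
  · obtain ⟨δ, hδ, hle⟩ := SturmBisection.exists_ofReal_lt_dist₂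
      (S := SturmBisection.realRoots p)
      (by rw [SturmBisection.realRoots_eq h0]; exact Finset.finite_toSet _)
    exact SturmBisection.exists_isTreeOf (by linarith) hδ fun c e hc hce he hlt =>
      hF c c e hc he (Set.left_mem_Icc.mpr hce)
        (((ENNReal.ofReal_lt_ofReal_iff hδ).mpr hlt).trans_le (hle c))
  · have hleaves := T.numLeaves_le (by linarith) hT hF
    refine ⟨hleaves, ?_⟩
    -- `d * (L + log d) ≥ 1` absorbs the 1 in the maximum.
    have h1 : (T.numLeaves : ENNReal) ≤
        ENNReal.ofReal (72 * (p.natDegree * (L + Real.log p.natDegree))) :=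
      hleaves.trans (max_le (ENNReal.one_le_ofReal.mpr (by linarith)) hI)
    rw [← ENNReal.ofReal_natCast, ENNReal.ofReal_le_ofReal_iff (by linarith)] at h1
    have h2 : (T.size : ℝ) + 1 = 2 * T.numLeaves := by exact_mod_cast T.size_add_one
    linarith
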